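/- For $n\ge 0$ let $\mathrm{Av}_n(123)$ be the set of permutations $p=p_1p_2\cdots p_n$ of $\{1,\dots,n\}$ containing no occurrence of the pattern $123$, where an occurrence of a pattern $q\in S_k$ in $p$ is a choice of positions $i_1<\cdots<i_k$ such that $p_{i_1}\cdots p_{i_k}$ is in the same relative order as $q$. Let $C(x)=\sum_{n\ge0}\frac{1}{n+1}\binom{2n}{n}x^n$ be the generating function of the Catalan numbers. Let $b_n$ be the total number of occurrences of $231$ in all permutations in $\mathrm{Av}_n(123)$. Then $b_n$ is also the total number of occurrences of $312$ in all permutations in $\mathrm{Av}_n(123)$, and, as formal power series, $$\sum_{n\ge0} b_nx^n=\frac{x^3C(x)^3}{(1-2xC(x))(1-4x)^{3/2}}=\frac12\left(\frac{1-3x}{(1-4x)^{2}}-\frac{4x^2-5x+1}{(1-4x)^{5/2}}\right).$$ -/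

import Mathlib

namespace PermPattern

/-- The position map `f` picks out an occurrence of the pattern `q ∈ S_k` in `p ∈ S_n`: the positions
`f 0 < f 1 < ⋯` increase, and the entries of `p` there are in the same relative order as those
of `q`. Permutations are in one-line notation (`p i` is the entry at position `i`), with positions
and entries counted from `0`. -/
abbrev IsOccurrence {n k : ℕ} (q : Equiv.Perm (Fin k)) (p : Equiv.Perm (Fin n))
    (f : Fin k → Fin n) : Prop :=
  (∀ i j, i < j → f i < f j) ∧ ∀ i j, q i < q j ↔ p (f i) < p (f j)

/-- `p` contains `q` as a pattern. -/
abbrev Contains {n k : ℕ} (q : Equiv.Perm (Fin k)) (p : Equiv.Perm (Fin n)) : Prop :=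
  ∃ f : Fin k → Fin n, IsOccurrence q p f

/-- The number of occurrences of `q` in `p`. -/
def num {n k : ℕ} (q : Equiv.Perm (Fin k)) (p : Equiv.Perm (Fin n)) : ℕ :=
  (Finset.univ.filter fun f : Fin k → Fin n => IsOccurrence q p f).card

/-- The set of permutations of length `n` that avoid `r`. -/
def Av (n : ℕ) {m : ℕ} (r : Equiv.Perm (Fin m)) : Finset (Equiv.Perm (Fin n)) :=
  Finset.univ.filter fun p => ¬ Contains r p

/-- The total number of occurrences of `q` in a finite set `S` of permutations of length `n`. -/
def total {n k : ℕ} (q : Equiv.Perm (Fin k)) (S : Finset (Equiv.Perm (Fin n))) : ℕ :=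
  ∑ p ∈ S, num q p

/-- The permutation 123. -/
def pat123 : Equiv.Perm (Fin 3) := 1

/-- The permutation 231. -/
def pat231 : Equiv.Perm (Fin 3) where
  toFun := ![1, 2, 0]
  invFun := ![2, 0, 1]
  left_inv := by decide
  right_inv := by decide

/-- The permutation 312. -/
def pat312 : Equiv.Perm (Fin 3) where
  toFun := ![2, 0, 1]
  invFun := ![1, 2, 0]
  left_inv := by decide
  right_inv := by decide

/-- The Catalan generating function `C(x)`, over the rationals. -/
noncomputable def catalanGF : PowerSeries ℚ :=
  PowerSeries.map (Nat.castRingHom ℚ) PowerSeries.catalanSeries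

/-- The formal power series `(1 - 4x)^r` for rational `r`: the binomial series `(1 + y)^r`
at `y = -4x`. -/
noncomputable def oneSubFourXPow (r : ℚ) : PowerSeries ℚ :=
  PowerSeries.rescale (-4 : ℚ) (PowerSeries.binomialSeries ℚ r)

end PermPattern

namespace PermPattern

open PowerSeries

/-! ### Inverses -/

theorem IsOccurrence.inv {n k : ℕ} {q : Equiv.Perm (Fin k)} {p : Equiv.Perm (Fin n)}
    {f : Fin k → Fin n} (h : IsOccurrence q p f) :
    IsOccurrence q⁻¹ p⁻¹ fun i => p (f (q⁻¹ i)) := by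
  refine ⟨fun i j hij => (h.2 _ _).1 (by simpa using hij), fun i j => ?_⟩
  have hf : StrictMono f := fun i j => h.1 i j
  simp [hf.lt_iff_lt]

theorem num_inv {n k : ℕ} (q : Equiv.Perm (Fin k)) (p : Equiv.Perm (Fin n)) :
    num q⁻¹ p⁻¹ = num q p := by
  unfold num
  symm
  refine Finset.card_bij' (fun f _ => fun i => p (f (q⁻¹ i)))
    (fun f _ => fun i => p⁻¹ (f (q i))) ?_ ?_ ?_ ?_
  · intro f hf
    simpa only [Finset.mem_filter, Finset.mem_univ, true_and] using
      IsOccurrence.inv (by simpa only [Finset.mem_filter, Finset.mem_univ, true_and] using hf)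
  · intro f hf
    have := IsOccurrence.inv (q := q⁻¹) (p := p⁻¹) (f := f)
      (by simpa only [Finset.mem_filter, Finset.mem_univ, true_and] using hf)
    simpa only [Finset.mem_filter, Finset.mem_univ, true_and, inv_inv] using this
  · intro f _; funext i; simp
  · intro f _; funext i; simp

theorem mem_Av_inv {n m : ℕ} {r : Equiv.Perm (Fin m)} {p : Equiv.Perm (Fin n)} :
    p⁻¹ ∈ Av n r⁻¹ ↔ p ∈ Av n r := by
  simp only [Av, Finset.mem_filter, Finset.mem_univ, true_and, not_iff_not]
  constructor
  · rintro ⟨f, hf⟩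
    exact ⟨_, by simpa only [inv_inv] using IsOccurrence.inv hf⟩
  · rintro ⟨f, hf⟩
    exact ⟨_, IsOccurrence.inv hf⟩

theorem total_inv {n k m : ℕ} (q : Equiv.Perm (Fin k)) (r : Equiv.Perm (Fin m)) :
    total q⁻¹ (Av n r⁻¹) = total q (Av n r) := by
  unfold total
  symm
  exact Finset.sum_bij' (fun p _ => p⁻¹) (fun p _ => p⁻¹)
    (fun p hp => mem_Av_inv.2 hp)
    (fun p hp => mem_Av_inv.1 (by rwa [inv_inv])) (by simp) (by simp)
    (fun p _ => (num_inv q p).symm)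

theorem total_pat231_eq_total_pat312 (n : ℕ) :
    total pat231 (Av n pat123) = total pat312 (Av n pat123) :=
  (total_inv pat231 pat123).symm

/-! ### Patterns of length three as triples of positions -/

theorem mem_Av_pat123 {n : ℕ} {p : Equiv.Perm (Fin n)} :
    p ∈ Av n pat123 ↔ ∀ i j k, i < j → j < k → p i < p j → ¬ p j < p k := by
  simp only [Av, Finset.mem_filter, Finset.mem_univ, true_and]
  constructor
  · intro h i j k hij hjk h1 h2
    refine h ⟨![i, j, k], ?_, ?_⟩
    · simp [Fin.forall_fin_succ, hij, hjk, hij.trans hjk]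
    · simp [Fin.forall_fin_succ, pat123, h1, h2, h1.trans h2, h1.le, h2.le, (h1.trans h2).le]
  · rintro h ⟨f, hf, hp⟩
    refine h (f 0) (f 1) (f 2) (hf _ _ (by decide)) (hf _ _ (by decide)) ?_ ?_
    · exact (hp 0 1).1 (by decide)
    · exact (hp 1 2).1 (by decide)

theorem num_pat312 {n : ℕ} (p : Equiv.Perm (Fin n)) :
    num pat312 p = ∑ k, ∑ j, ∑ i,
      if i < j ∧ j < k ∧ p j < p k ∧ p k < p i then 1 else 0 := by
  have h : num pat312 p = ∑ x : Fin n × Fin n × Fin n,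
      if x.2.2 < x.2.1 ∧ x.2.1 < x.1 ∧ p x.2.1 < p x.1 ∧ p x.1 < p x.2.2 then 1 else 0 := by
    rw [← Finset.sum_filter, ← Finset.card_eq_sum_ones]
    refine Finset.card_bij' (fun f _ => (f 2, f 1, f 0)) (fun x _ => ![x.2.2, x.2.1, x.1])
      ?_ ?_ ?_ ?_
    · intro f hf
      simp only [Finset.mem_filter, Finset.mem_univ, true_and] at hf ⊢
      exact ⟨hf.1 _ _ (by decide), hf.1 _ _ (by decide), (hf.2 1 2).1 (by decide),
        (hf.2 2 0).1 (by decide)⟩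
    · rintro ⟨k, j, i⟩ hx
      simp only [Finset.mem_filter, Finset.mem_univ, true_and] at hx ⊢
      obtain ⟨h1, h2, h3, h4⟩ := hx
      constructor
      · simp [Fin.forall_fin_succ, h1, h2, h1.trans h2]
      · simp [Fin.forall_fin_succ, pat312, h3, h4, h3.trans h4, h3.le, h4.le, (h3.trans h4).le]
    · intro f _
      funext i
      fin_cases i <;> rfl
    · intro x _
      rfl
  rw [h, Fintype.sum_prod_type]
  simp_rw [Fintype.sum_prod_type]

/-! ### Appending a last entry -/

/-- Append the entry `v` to `σ`, raising the entries that are at least `v` by one. -/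
def snocPerm {n : ℕ} (v : Fin (n + 1)) (σ : Equiv.Perm (Fin n)) : Equiv.Perm (Fin (n + 1)) :=
  (finSuccEquiv' (Fin.last n)).trans ((Equiv.optionCongr σ).trans (finSuccEquiv' v).symm)

@[simp] theorem snocPerm_last {n : ℕ} (v : Fin (n + 1)) (σ : Equiv.Perm (Fin n)) :
    snocPerm v σ (Fin.last n) = v := by
  simp [snocPerm]

@[simp] theorem snocPerm_castSucc {n : ℕ} (v : Fin (n + 1)) (σ : Equiv.Perm (Fin n))
    (i : Fin n) : snocPerm v σ i.castSucc = v.succAbove (σ i) := by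
  simp [snocPerm, finSuccEquiv'_last_apply_castSucc]

theorem snocPerm_bijective (n : ℕ) :
    Function.Bijective fun x : Fin (n + 1) × Equiv.Perm (Fin n) => snocPerm x.1 x.2 := by
  rw [Fintype.bijective_iff_injective_and_card]
  constructor
  · rintro ⟨v, σ⟩ ⟨v', σ'⟩ h
    have hv : v = v' := by simpa using Equiv.congr_fun h (Fin.last n)
    subst hv
    have hσ : σ = σ' := by
      ext i
      have := Equiv.congr_fun h i.castSucc
      simp only [snocPerm_castSucc] at this
      rw [Fin.succAbove_right_injective this]
    rw [hσ]
  · simp [Fintype.card_perm, Nat.factorial_succ]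

theorem succAbove_val_lt_iff {n : ℕ} {v : Fin (n + 1)} {x : Fin n} {t : ℕ} (h : t ≤ v.val) :
    (v.succAbove x).val < t ↔ x.val < t := by
  rw [Fin.succAbove]
  split_ifs with hx
  · simp
  · simp only [Fin.lt_def, Fin.val_castSucc, not_lt, Fin.val_succ] at *
    omega

theorem succAbove_lt_self_iff {n : ℕ} {v : Fin (n + 1)} {x : Fin n} :
    v.succAbove x < v ↔ x.val < v.val := by
  rw [Fin.lt_def, succAbove_val_lt_iff le_rfl]

/-- The entries less than `s` form a decreasing sequence of length `s`. -/
abbrev LowDecreasing {n : ℕ} (s : ℕ) (p : Equiv.Perm (Fin n)) : Prop :=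
  s ≤ n ∧ ∀ i j, i < j → (p i).val < s → (p j).val < s → p j < p i

/-- The number of inversions of `p` between an entry at least `t` and an entry less than `t`. -/
def cutInv {n : ℕ} (t : ℕ) (p : Equiv.Perm (Fin n)) : ℕ :=
  ∑ j, ∑ i, if i < j ∧ (p j).val < t ∧ t ≤ (p i).val then 1 else 0

theorem cutInv_zero {n : ℕ} (p : Equiv.Perm (Fin n)) : cutInv 0 p = 0 := by
  simp [cutInv]

theorem cutInv_snocPerm_of_le {n t : ℕ} {v : Fin (n + 1)} (h : t ≤ v.val)
    (σ : Equiv.Perm (Fin n)) : cutInv t (snocPerm v σ) = cutInv t σ := by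
  have h' : ∀ x : Fin n, t ≤ (v.succAbove x).val ↔ t ≤ x.val := fun x => by
    rw [← not_lt, succAbove_val_lt_iff h, not_lt]
  simp [-Finset.sum_boole, cutInv, Fin.sum_univ_castSucc, succAbove_val_lt_iff h, h', h.not_gt,
    Fin.not_lt.2 (Fin.le_last _)]

theorem card_perm_ge {n : ℕ} (t : ℕ) (σ : Equiv.Perm (Fin n)) :
    (∑ i, if t ≤ (σ i).val then 1 else 0) = n - t := by
  rw [Equiv.sum_comp σ (fun x : Fin n => if t ≤ x.val then 1 else 0),
    Fin.sum_univ_eq_sum_range (fun x => if t ≤ x then 1 else 0), ← Finset.sum_filter,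
    ← Finset.card_eq_sum_ones]
  have : (Finset.range n).filter (t ≤ ·) = Finset.Ico t n := by
    ext x; simp [and_comm]
  rw [this, Nat.card_Ico]

theorem cutInv_succ_snocPerm_zero {n : ℕ} (t : ℕ) (σ : Equiv.Perm (Fin n)) :
    cutInv (t + 1) (snocPerm 0 σ) = cutInv t σ + (n - t) := by
  rw [← card_perm_ge t σ]
  simp [-Finset.sum_boole, cutInv, Fin.sum_univ_castSucc, Fin.not_lt.2 (Fin.le_last _)]

theorem num_pat312_snocPerm {n : ℕ} (v : Fin (n + 1)) (σ : Equiv.Perm (Fin n)) :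
    num pat312 (snocPerm v σ) = num pat312 σ + cutInv v σ := by
  have h' : ∀ x : Fin n, v < v.succAbove x ↔ v.val ≤ x.val := fun x => by
    rw [← not_lt, ← succAbove_lt_self_iff, not_lt, le_iff_lt_or_eq,
      or_iff_left (Fin.succAbove_ne v x).symm]
  simp [-Finset.sum_boole, num_pat312, cutInv, Fin.sum_univ_castSucc, Fin.not_lt.2 (Fin.le_last _),
    succAbove_lt_self_iff, h']

theorem snocPerm_mem_Av {n : ℕ} (v : Fin (n + 1)) (σ : Equiv.Perm (Fin n)) :
    snocPerm v σ ∈ Av (n + 1) pat123 ↔ σ ∈ Av n pat123 ∧ LowDecreasing v σ := by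
  simp only [mem_Av_pat123, Fin.forall_fin_succ', Fin.not_lt.2 (Fin.le_last _)]
  simp only [snocPerm_castSucc, snocPerm_last, Fin.castSucc_lt_castSucc_iff,
    Fin.succAbove_lt_succAbove_iff, succAbove_lt_self_iff, Fin.castSucc_lt_last]
  constructor
  · intro h
    refine ⟨fun i j k => (h.1 i).1 j |>.1 k, by omega, fun i j hij hi hj => ?_⟩
    by_contra hc
    refine ((h.1 i).1 j).2 hij trivial ?_ hj
    exact lt_of_le_of_ne (not_lt.1 hc) fun e => hij.ne (σ.injective e)
  · rintro ⟨h, -, hd⟩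
    refine ⟨fun i => ⟨fun j => ⟨fun k => h i j k, fun hij _ hσ hj => ?_⟩, by simp⟩, by simp⟩
    exact (hd i j hij (lt_trans (Fin.lt_def.1 hσ) hj) hj).not_gt hσ

theorem LowDecreasing.mono {n s t : ℕ} {p : Equiv.Perm (Fin n)} (h : LowDecreasing t p)
    (hst : s ≤ t) : LowDecreasing s p :=
  ⟨hst.trans h.1, fun i j hij hi hj => h.2 i j hij (hi.trans_le hst) (hj.trans_le hst)⟩

theorem lowDecreasing_succ_snocPerm_zero {n : ℕ} (s : ℕ) (σ : Equiv.Perm (Fin n)) :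
    LowDecreasing (s + 1) (snocPerm 0 σ) ↔ LowDecreasing s σ := by
  simp [LowDecreasing, Fin.forall_fin_succ', Fin.not_lt.2 (Fin.le_last _)]

theorem lowDecreasing_snocPerm {n s : ℕ} {v : Fin (n + 1)} (hv : v ≠ 0) {σ : Equiv.Perm (Fin n)}
    (h : LowDecreasing v σ) : LowDecreasing s (snocPerm v σ) ↔ s ≤ v.val := by
  constructor
  · intro hs
    by_contra! hlt
    have hn : 0 < n := by
      have := Fin.pos_iff_ne_zero.2 hv
      rw [Fin.lt_def] at this
      have := v.isLt
      simp at *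
      omega
    have : NeZero n := ⟨hn.ne'⟩
    have h0 : v.succAbove (0 : Fin n) = 0 := Fin.succAbove_ne_zero_zero hv
    have := hs.2 (σ⁻¹ 0).castSucc (Fin.last n) (Fin.castSucc_lt_last _)
      (by simp [h0]; omega) (by simpa using hlt)
    simp [h0] at this
  · intro hs
    refine ⟨by omega, ?_⟩
    have := (h.mono hs).2
    simpa [Fin.forall_fin_succ', Fin.not_lt.2 (Fin.le_last _), succAbove_val_lt_iff hs,
      hs.not_gt] using this

/-- The `123`-avoiding permutations of length `n` whose entries less than `s` form a decreasing
sequence of length `s`. -/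
def avLow (n s : ℕ) : Finset (Equiv.Perm (Fin n)) :=
  (Av n pat123).filter (LowDecreasing s)

theorem avLow_eq_empty {n s : ℕ} (h : n < s) : avLow n s = ∅ := by
  ext p
  simp only [avLow, Finset.mem_filter, Finset.notMem_empty, iff_false]
  exact fun hp => h.not_ge hp.2.1

theorem avLow_zero (n : ℕ) : avLow n 0 = Av n pat123 := by
  simp [avLow, LowDecreasing]

theorem avLow_one {n : ℕ} (h : n ≠ 0) : avLow n 1 = avLow n 0 := by
  ext p
  simp only [avLow, Finset.mem_filter, and_congr_right_iff]
  refine fun _ => ⟨fun hp => hp.mono zero_le_one, fun _ => ⟨by omega, fun i j hij hi hj => ?_⟩⟩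
  exact absurd (p.injective (Fin.ext (by omega))) hij.ne

theorem snocPerm_mem_avLow {n s : ℕ} (v : Fin (n + 1)) (σ : Equiv.Perm (Fin n)) :
    snocPerm v σ ∈ avLow (n + 1) (s + 1) ↔
      (v = 0 ∧ σ ∈ avLow n s) ∨ (s + 1 ≤ v.val ∧ σ ∈ avLow n v) := by
  simp only [avLow, Finset.mem_filter, snocPerm_mem_Av]
  by_cases hv : v = 0
  · subst hv
    rw [lowDecreasing_succ_snocPerm_zero]
    simp [LowDecreasing]
  · constructor
    · rintro ⟨⟨h1, h2⟩, h3⟩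
      exact Or.inr ⟨(lowDecreasing_snocPerm hv h2).1 h3, h1, h2⟩
    · rintro (h | ⟨h1, h2, h3⟩)
      · exact absurd h.1 hv
      · exact ⟨⟨h2, h3⟩, (lowDecreasing_snocPerm hv h3).2 h1⟩

theorem sum_avLow_succ {n s : ℕ} (f : Equiv.Perm (Fin (n + 1)) → ℚ)
    (g : ℕ → Equiv.Perm (Fin n) → ℚ)
    (hg : ∀ v : Fin (n + 1), s + 1 ≤ v.val → ∀ σ, f (snocPerm v σ) = g v σ) :
    ∑ p ∈ avLow (n + 1) (s + 1), f p =
      ∑ σ ∈ avLow n s, f (snocPerm 0 σ) +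
        ∑ v ∈ Finset.Ico (s + 1) (n + 1), ∑ σ ∈ avLow n v, g v σ := by
  have h1 : ∑ p ∈ avLow (n + 1) (s + 1), f p =
      ∑ v : Fin (n + 1), ∑ σ, if snocPerm v σ ∈ avLow (n + 1) (s + 1)
        then f (snocPerm v σ) else 0 := by
    rw [← Fintype.sum_prod_type', (snocPerm_bijective n).sum_comp
      (fun p => if p ∈ avLow (n + 1) (s + 1) then f p else 0), Finset.sum_ite_mem,
      Finset.univ_inter]
  have h2 : ∑ v ∈ Finset.Ico (s + 1) (n + 1), ∑ σ ∈ avLow n v, g v σ =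
      ∑ v : Fin n, if s + 1 ≤ v.succ.val then ∑ σ ∈ avLow n v.succ.val, g v.succ.val σ else 0 := by
    have h := Fin.sum_univ_eq_sum_range
      (fun v => if s + 1 ≤ v then ∑ σ ∈ avLow n v, g v σ else 0) (n + 1)
    rw [Fin.sum_univ_succ] at h
    simp only [Fin.val_zero, Nat.le_zero_eq, Nat.add_eq_zero_iff, one_ne_zero, and_false,
      if_false, zero_add] at h
    rw [h, ← Finset.sum_filter]
    congr 1
    ext v
    simp [and_comm]
  rw [h1, h2, Fin.sum_univ_succ]
  congr 1
  · simp only [snocPerm_mem_avLow]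
    simp
  · refine Finset.sum_congr rfl fun v _ => ?_
    simp only [snocPerm_mem_avLow]
    split_ifs with h
    · simp only [Fin.succ_ne_zero, false_and, false_or, h, true_and, Finset.sum_ite_mem,
        Finset.univ_inter]
      exact Finset.sum_congr rfl fun σ _ => hg _ h σ
    · simp only [Fin.succ_ne_zero, h, false_and, or_self, if_false, Finset.sum_const_zero]

theorem sum_avLow_succ_sub {n s : ℕ} (f : Equiv.Perm (Fin (n + 1)) → ℚ)
    (g : ℕ → Equiv.Perm (Fin n) → ℚ)
    (hg : ∀ v : Fin (n + 1), s + 1 ≤ v.val → ∀ σ, f (snocPerm v σ) = g v σ) :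
    ∑ p ∈ avLow (n + 1) (s + 1), f p - ∑ p ∈ avLow (n + 1) (s + 2), f p =
      ∑ σ ∈ avLow n s, f (snocPerm 0 σ) - ∑ σ ∈ avLow n (s + 1), f (snocPerm 0 σ) +
        ∑ σ ∈ avLow n (s + 1), g (s + 1) σ := by
  rw [sum_avLow_succ f g hg, sum_avLow_succ f g fun v hv => hg v (by omega)]
  rcases lt_or_ge n (s + 1) with h | h
  · rw [Finset.Ico_eq_empty (by omega), Finset.Ico_eq_empty (by omega), avLow_eq_empty h]
    simp
  · rw [Finset.sum_eq_sum_Ico_succ_bot (show s + 1 < n + 1 by omega)]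
    ring

/-- The generating function of a statistic `f` over the sets `avLow n s`. -/
noncomputable def lowGF (f : ∀ n, Equiv.Perm (Fin n) → ℚ) (s : ℕ) : ℚ⟦X⟧ :=
  PowerSeries.mk fun n => ∑ p ∈ avLow n s, f n p

theorem X_pow_dvd_lowGF (f : ∀ n, Equiv.Perm (Fin n) → ℚ) (s : ℕ) : X ^ s ∣ lowGF f s := by
  rw [X_pow_dvd_iff]
  intro m hm
  simp [lowGF, avLow_eq_empty hm]

theorem lowGF_zero (f : ∀ n, Equiv.Perm (Fin n) → ℚ) :
    lowGF f 0 = C (f 0 1) + lowGF f 1 := by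
  ext n
  rcases eq_or_ne n 0 with rfl | hn
  · have h : Av 0 pat123 = Finset.univ := by
      ext p
      simp [mem_Av_pat123, Subsingleton.elim p 1]
    simp [lowGF, avLow_zero, avLow_eq_empty, h]
  · simp [lowGF, avLow_one hn, coeff_C, hn]

/-- The step from length `n` to length `n + 1`, for a statistic `f` that becomes `g` on appending
a smallest last entry, and `h` on appending the last entry `s + 1`. -/
theorem lowGF_sub (f g : ∀ n, Equiv.Perm (Fin n) → ℚ) (h : ℕ → ∀ n, Equiv.Perm (Fin n) → ℚ)
    (s : ℕ) (hg : ∀ n, ∀ σ ∈ avLow n s, f (n + 1) (snocPerm 0 σ) = g n σ)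
    (hh : ∀ n, ∀ v : Fin (n + 1), s + 1 ≤ v.val → ∀ σ, f (n + 1) (snocPerm v σ) = h v n σ) :
    lowGF f (s + 1) - lowGF f (s + 2) =
      X * (lowGF g s - lowGF g (s + 1) + lowGF (h (s + 1)) (s + 1)) := by
  ext n
  cases n with
  | zero => simp [lowGF, avLow_eq_empty]
  | succ n =>
    rw [coeff_succ_X_mul]
    simp only [lowGF, map_sub, map_add, coeff_mk]
    rw [sum_avLow_succ_sub _ (fun v σ => h v n σ) (hh n), Finset.sum_congr rfl (hg n),
      Finset.sum_congr rfl fun σ hσ => hg n σ ?_]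
    rw [avLow, Finset.mem_filter] at hσ ⊢
    exact ⟨hσ.1, hσ.2.mono (Nat.le_succ s)⟩

/-- The uniqueness principle for the recurrences satisfied by the series `lowGF f s`. -/
theorem eq_zero_of_X_pow_dvd_sub {D : ℕ → ℚ⟦X⟧} (h0 : ∀ k, X ^ k ∣ D k)
    (h : ∀ m, (∀ k, X ^ m ∣ D k) → ∀ k, X ^ (m + 1) ∣ D k - D (k + 1)) (k : ℕ) : D k = 0 := by
  have key : ∀ m k, X ^ m ∣ D k := by
    intro m
    induction m with
    | zero => simp
    | succ m ih =>
      have hd : ∀ i k, X ^ (m + 1) ∣ D k - D (k + i) := by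
        intro i
        induction i with
        | zero => simp
        | succ i ihi =>
          intro k
          have := dvd_add (ihi k) (h m ih (k + i))
          rwa [sub_add_sub_cancel] at this
      intro k
      have h1 := hd (m + 1) k
      have h2 : X ^ (m + 1) ∣ D (k + (m + 1)) := (pow_dvd_pow X (by omega)).trans (h0 _)
      simpa using dvd_add h1 h2
  ext n
  rw [map_zero]
  exact (X_pow_dvd_iff.1 (key (n + 1) k)) n n.lt_succ_self

/-! ### The four families of generating functions -/

/-- The generating function of the number of permutations. -/
noncomputable def countGF : ℕ → ℚ⟦X⟧ := lowGF fun _ _ => 1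

/-- The generating function of the total length. -/
noncomputable def lengthGF : ℕ → ℚ⟦X⟧ := lowGF fun n _ => n

/-- The generating function of the statistic `cutInv t`. -/
noncomputable def cutInvGF (t : ℕ) : ℕ → ℚ⟦X⟧ := lowGF fun _ p => cutInv t p

/-- The generating function of the number of occurrences of `312`. -/
noncomputable def occGF : ℕ → ℚ⟦X⟧ := lowGF fun _ p => num pat312 p

theorem lowGF_add (f g : ∀ n, Equiv.Perm (Fin n) → ℚ) (s : ℕ) :
    lowGF (fun n p => f n p + g n p) s = lowGF f s + lowGF g s := by
  ext n
  simp [lowGF, Finset.sum_add_distrib]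

theorem lowGF_const_mul (a : ℚ) (f : ∀ n, Equiv.Perm (Fin n) → ℚ) (s : ℕ) :
    lowGF (fun n p => a * f n p) s = C a * lowGF f s := by
  ext n
  simp [lowGF, Finset.mul_sum]

theorem countGF_sub (s : ℕ) : countGF (s + 1) - countGF (s + 2) = X * countGF s := by
  rw [countGF, lowGF_sub _ (fun _ _ => 1) (fun _ _ _ => 1) s (fun _ _ _ => rfl)
    fun _ _ _ _ => rfl]
  ring

theorem lengthGF_sub (s : ℕ) :
    lengthGF (s + 1) - lengthGF (s + 2) = X * (lengthGF s + countGF s) := by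
  rw [lengthGF, countGF, lowGF_sub _ (fun n _ => n + 1) (fun _ n _ => n + 1) s
    (fun _ _ _ => by push_cast; rfl) fun _ _ _ _ => by push_cast; rfl]
  rw [← lowGF_add]
  ring

theorem cutInvGF_sub {s t : ℕ} (h : t ≤ s) :
    cutInvGF (t + 1) (s + 1) - cutInvGF (t + 1) (s + 2) =
      X * (cutInvGF t s - cutInvGF t (s + 1) + (lengthGF s - lengthGF (s + 1)) -
        (t : ℚ⟦X⟧) * (countGF s - countGF (s + 1)) + cutInvGF (t + 1) (s + 1)) := by
  rw [cutInvGF, lowGF_sub _ (fun n p => cutInv t p + (n + (-t : ℚ) * 1))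
    (fun _ _ p => cutInv (t + 1) p) s ?_ fun n v hv σ => by
      rw [cutInv_snocPerm_of_le (by omega)]]
  · simp only [lowGF_add, lowGF_const_mul, ← countGF.eq_1, ← lengthGF.eq_1, ← cutInvGF.eq_1]
    simp only [map_neg, map_natCast]
    ring
  · intro n σ hσ
    have hn : t ≤ n := h.trans (Finset.mem_filter.1 hσ).2.1
    rw [cutInv_succ_snocPerm_zero]
    push_cast [hn]
    ring

theorem cutInvGF_zero (s : ℕ) : cutInvGF 0 s = 0 := by
  ext n
  simp [cutInvGF, lowGF, cutInv_zero]

theorem occGF_sub (s : ℕ) :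
    occGF (s + 1) - occGF (s + 2) = X * (occGF s + cutInvGF (s + 1) (s + 1)) := by
  rw [occGF, lowGF_sub _ (fun n p => num pat312 p)
    (fun v _ p => num pat312 p + cutInv v p) s
    (fun n σ _ => by simp [num_pat312_snocPerm, cutInv_zero])
    fun n v hv σ => by rw [num_pat312_snocPerm]; push_cast; rfl]
  rw [lowGF_add, ← cutInvGF.eq_1]
  ring

theorem num_perm_zero : num pat312 (1 : Equiv.Perm (Fin 0)) = 0 := by
  simp [num_pat312]

theorem countGF_zero : countGF 0 = 1 + countGF 1 := by
  rw [countGF, lowGF_zero]; simp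

theorem lengthGF_zero : lengthGF 0 = lengthGF 1 := by
  rw [lengthGF, lowGF_zero]; simp

theorem occGF_zero : occGF 0 = occGF 1 := by
  rw [occGF, lowGF_zero]; simp [num_perm_zero]

/-! ### Closed forms -/

section ClosedForms

variable {r c w : ℚ⟦X⟧}

theorem X_pow_dvd_pow_mul (hr : X = r * (1 - r)) (hc : c * (1 - r) = 1) (s : ℕ) (a : ℚ⟦X⟧) :
    X ^ s ∣ r ^ s * a := by
  have : r = X * c := by linear_combination (-r) * hc - c * hr
  exact (pow_dvd_pow_of_dvd (Dvd.intro _ this.symm) s).mul_right a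

theorem countGF_eq (hr : X = r * (1 - r)) (hc : c * (1 - r) = 1) (s : ℕ) :
    countGF s = r ^ s * c := by
  rw [← sub_eq_zero]
  refine eq_zero_of_X_pow_dvd_sub (D := fun s => countGF s - r ^ s * c)
    (fun k => dvd_sub (X_pow_dvd_lowGF _ k) (X_pow_dvd_pow_mul hr hc k c)) (fun m hm k => ?_) s
  cases k with
  | zero =>
    have : countGF 0 - r ^ 0 * c - (countGF (0 + 1) - r ^ (0 + 1) * c) = 0 := by
      linear_combination countGF_zero - hc
    rw [this]
    exact dvd_zero _
  | succ k =>
    have : countGF (k + 1) - r ^ (k + 1) * c - (countGF (k + 2) - r ^ (k + 2) * c) =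
        X * (countGF k - r ^ k * c) := by
      linear_combination countGF_sub k + r ^ k * c * hr
    rw [this, pow_succ']
    exact mul_dvd_mul_left X (hm k)

theorem lengthGF_eq (hr : X = r * (1 - r)) (hc : c * (1 - r) = 1) (hw : w * (1 - 2 * r) = 1)
    (s : ℕ) : lengthGF s = r ^ s * (w * (c * r + (s : ℚ⟦X⟧))) := by
  rw [← sub_eq_zero]
  refine eq_zero_of_X_pow_dvd_sub (D := fun s => lengthGF s - r ^ s * (w * (c * r + (s : ℚ⟦X⟧))))
    (fun k => dvd_sub (X_pow_dvd_lowGF _ k) (X_pow_dvd_pow_mul hr hc k _)) (fun m hm k => ?_) s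
  cases k with
  | zero =>
    have : lengthGF 0 - r ^ 0 * (w * (c * r + ((0 : ℕ) : ℚ⟦X⟧))) -
        (lengthGF (0 + 1) - r ^ (0 + 1) * (w * (c * r + ((0 + 1 : ℕ) : ℚ⟦X⟧)))) = 0 := by
      push_cast
      linear_combination lengthGF_zero - w * r * hc
    rw [this]
    exact dvd_zero _
  | succ k =>
    have : lengthGF (k + 1) - r ^ (k + 1) * (w * (c * r + ((k + 1 : ℕ) : ℚ⟦X⟧))) -
        (lengthGF (k + 2) - r ^ (k + 2) * (w * (c * r + ((k + 2 : ℕ) : ℚ⟦X⟧)))) =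
        X * (lengthGF k - r ^ k * (w * (c * r + (k : ℚ⟦X⟧)))) := by
      have h := lengthGF_sub k
      rw [countGF_eq hr hc] at h
      push_cast
      generalize lengthGF (k + 1) = a1 at *
      generalize lengthGF (k + 2) = a2 at *
      generalize lengthGF k = a0 at *
      rw [show r ^ (k + 2) = r ^ k * r * r by ring, pow_succ]
      generalize r ^ k = R at *
      generalize (k : ℚ⟦X⟧) = K at *
      clear hm
      grind
    rw [this, pow_succ']
    exact mul_dvd_mul_left X (hm k)

theorem cutInvGF_eq (hr : X = r * (1 - r)) (hc : c * (1 - r) = 1) (hw : w * (1 - 2 * r) = 1)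
    {s t : ℕ} (hst : t ≤ s) :
    cutInvGF t s = r ^ s * ((t : ℚ⟦X⟧) * (w * (s : ℚ⟦X⟧) + w * r * c -
      C (1 / 2) * (c ^ 2 * ((t : ℚ⟦X⟧) + 1) + c * ((t : ℚ⟦X⟧) - 1)))) := by
  induction t generalizing s with
  | zero => simp [cutInvGF_zero]
  | succ t ih =>
    obtain ⟨s, rfl⟩ := Nat.exists_eq_add_of_le' hst
    have h2 : 2 * C (1 / 2 : ℚ) = (1 : ℚ⟦X⟧) := by
      rw [← map_ofNat (C (R := ℚ)) 2, ← map_mul]; norm_num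
    rw [← sub_eq_zero]
    refine eq_zero_of_X_pow_dvd_sub (D := fun s => cutInvGF (t + 1) (s + (t + 1)) -
      r ^ (s + (t + 1)) * (((t + 1 : ℕ) : ℚ⟦X⟧) * (w * ((s + (t + 1) : ℕ) : ℚ⟦X⟧) + w * r * c -
      C (1 / 2) * (c ^ 2 * (((t + 1 : ℕ) : ℚ⟦X⟧) + 1) + c * (((t + 1 : ℕ) : ℚ⟦X⟧) - 1)))))
      (fun k => dvd_sub ((pow_dvd_pow X (by omega)).trans (X_pow_dvd_lowGF _ (k + (t + 1))))
        ((pow_dvd_pow X (by omega)).trans (X_pow_dvd_pow_mul hr hc (k + (t + 1)) _)))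
      (fun m hm k => ?_) s
    have h := cutInvGF_sub (s := k + t) (t := t) (by omega)
    rw [ih (by omega), ih (by omega), lengthGF_eq hr hc hw, lengthGF_eq hr hc hw,
      countGF_eq hr hc, countGF_eq hr hc] at h
    have hm' := mul_dvd_mul_left X (hm k)
    rw [← pow_succ'] at hm'
    convert hm' using 1
    rw [show k + 1 + (t + 1) = k + t + 2 by ring, show k + (t + 1) = k + t + 1 by ring]
    push_cast at h ⊢
    rw [pow_succ r (k + t)] at h
    rw [show r ^ (k + t + 2) = r ^ (k + t) * r * r by ring, pow_succ r (k + t)]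
    generalize cutInvGF (t + 1) (k + t + 1) = a1 at *
    generalize cutInvGF (t + 1) (k + t + 2) = a2 at *
    generalize C (1 / 2 : ℚ) = b at *
    generalize r ^ (k + t) = R at *
    generalize (k : ℚ⟦X⟧) = K at *
    generalize (t : ℚ⟦X⟧) = T at *
    have hc2 : c ^ 2 * (1 - r) ^ 2 = 1 := by rw [← mul_pow, hc, one_pow]
    linear_combination h +
      (R * (T * (w * (K + T) + w * r * c - b * (c ^ 2 * (T + 1) + c * (T - 1)))) -
        R * r * (T * (w * (K + T + 1) + w * r * c - b * (c ^ 2 * (T + 1) + c * (T - 1)))) +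
        (R * (w * (c * r + (K + T))) - R * r * (w * (c * r + (K + T + 1)))) -
        T * (R * c - R * r * c) +
        R * r * ((T + 1) * (w * (K + T + 1) + w * r * c -
          b * (c ^ 2 * (T + 1 + 1) + c * (T + 1 - 1))))) * hr -
      R * r * ((T * b * (T + 1) - (T + 1) * b * (T + 2)) * hc2 +
        (1 - r) * ((T + 1) * (w * r - b * T) - T * (w * r - b * (T - 1)) - w * r + T) * hc +
        (T + 1) * hw - (T + 1 + T * (1 - r)) * h2)

theorem cutInvGF_self (hr : X = r * (1 - r)) (hc : c * (1 - r) = 1) (hw : w * (1 - 2 * r) = 1)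
    (s : ℕ) :
    cutInvGF s s = r ^ s * (C (1 / 2) * (r * w * c ^ 2) * ((s : ℚ⟦X⟧) * ((s : ℚ⟦X⟧) + 1))) := by
  have h2 : 2 * C (1 / 2 : ℚ) = (1 : ℚ⟦X⟧) := by
    rw [← map_ofNat (C (R := ℚ)) 2, ← map_mul]; norm_num
  rw [cutInvGF_eq hr hc hw le_rfl]
  congr 1
  generalize C (1 / 2 : ℚ) = h at *
  grind

theorem occGF_eq (hr : X = r * (1 - r)) (hc : c * (1 - r) = 1) (hw : w * (1 - 2 * r) = 1)
    (s : ℕ) :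
    occGF s = r ^ s * (r ^ 3 * w ^ 4 + r ^ 2 * w ^ 4 * (1 - r) * (s : ℚ⟦X⟧) +
      C (1 / 2) * (r ^ 2 * w ^ 3 * c * (2 - 3 * r)) * ((s : ℚ⟦X⟧) * ((s : ℚ⟦X⟧) - 1)) +
      C (1 / 6) * (r ^ 2 * w ^ 2 * c) *
        ((s : ℚ⟦X⟧) * ((s : ℚ⟦X⟧) - 1) * ((s : ℚ⟦X⟧) - 2))) := by
  have h2 : 2 * C (1 / 2 : ℚ) = (1 : ℚ⟦X⟧) := by
    rw [← map_ofNat (C (R := ℚ)) 2, ← map_mul]; norm_num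
  have h6 : 3 * C (1 / 6 : ℚ) = (C (1 / 2) : ℚ⟦X⟧) := by
    rw [← map_ofNat (C (R := ℚ)) 3, ← map_mul]; norm_num
  rw [← sub_eq_zero]
  refine eq_zero_of_X_pow_dvd_sub (D := fun s => occGF s -
      r ^ s * (r ^ 3 * w ^ 4 + r ^ 2 * w ^ 4 * (1 - r) * (s : ℚ⟦X⟧) +
      C (1 / 2) * (r ^ 2 * w ^ 3 * c * (2 - 3 * r)) * ((s : ℚ⟦X⟧) * ((s : ℚ⟦X⟧) - 1)) +
      C (1 / 6) * (r ^ 2 * w ^ 2 * c) *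
        ((s : ℚ⟦X⟧) * ((s : ℚ⟦X⟧) - 1) * ((s : ℚ⟦X⟧) - 2))))
    (fun k => dvd_sub (X_pow_dvd_lowGF _ k) (X_pow_dvd_pow_mul hr hc k _)) (fun m hm k => ?_) s
  cases k with
  | zero =>
    convert dvd_zero _ using 1
    push_cast
    linear_combination occGF_zero
  | succ k =>
    have h := occGF_sub k
    rw [cutInvGF_self hr hc hw] at h
    have hm' := mul_dvd_mul_left X (hm k)
    rw [← pow_succ'] at hm'
    convert hm' using 1
    push_cast at h ⊢
    rw [add_assoc k 1 1, one_add_one_eq_two]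
    rw [pow_succ] at h
    rw [show r ^ (k + 2) = r ^ k * r * r by ring, pow_succ]
    generalize occGF (k + 1) = a1 at *
    generalize occGF (k + 2) = a2 at *
    generalize occGF k = a0 at *
    generalize C (1 / 2 : ℚ) = b at *
    generalize C (1 / 6 : ℚ) = d at *
    generalize r ^ k = R at *
    generalize (k : ℚ⟦X⟧) = K at *
    have k0 : r ^ 2 * w ^ 4 * (1 - r) * (1 - 2 * r) - r * (r ^ 2 * w ^ 3 * c * (2 - 3 * r)) =
        r ^ 2 * w * c := by
      clear h
      grind
    have k1 : r ^ 2 * w ^ 3 * c * (2 - 3 * r) * (1 - 2 * r) - r * (r ^ 2 * w ^ 2 * c) =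
        2 * (r ^ 2 * w * c) := by
      clear h k0
      grind
    have k2 : r ^ 2 * w ^ 2 * c * (1 - 2 * r) = r ^ 2 * w * c := by
      linear_combination r ^ 2 * w * c * hw
    linear_combination h - R * r * (k0 + K * k1 + b * K * (K - 1) * k2) +
      R * (r ^ 3 * w ^ 4 + r ^ 2 * w ^ 4 * (1 - r) * K +
        b * (r ^ 2 * w ^ 3 * c * (2 - 3 * r)) * (K * (K - 1)) +
        d * (r ^ 2 * w ^ 2 * c) * (K * (K - 1) * (K - 2)) +
        r * (b * (r * w * c ^ 2) * ((K + 1) * (K + 2)))) * hr +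
      R * r * b * r ^ 2 * w * c * (K + 1) * (K + 2) * hc -
      R * r * (r ^ 2 * w ^ 3 * c * (2 - 3 * r) * ((1 - 2 * r) * K - r) -
        r ^ 2 * w ^ 2 * c * r * K - r ^ 2 * w * c * (2 * K + 1)) * h2 -
      R * r * (r ^ 2 * w ^ 2 * c) * ((1 - 2 * r) * K * (K - 1) - 2 * r * K) * h6

end ClosedForms

/-! ### The Catalan series and the powers of `1 - 4x` -/

theorem catalanGF_eq : catalanGF ^ 2 * X + 1 = catalanGF := by
  have h := congrArg (PowerSeries.map (Nat.castRingHom ℚ)) catalanSeries_sq_mul_X_add_one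
  simpa [catalanGF] using h

theorem oneSubFourXPow_add (a b : ℚ) :
    oneSubFourXPow (a + b) = oneSubFourXPow a * oneSubFourXPow b := by
  simp [oneSubFourXPow, binomialSeries_add]

theorem oneSubFourXPow_one : oneSubFourXPow 1 = 1 - 4 * X := by
  have h := binomialSeries_nat (R := ℚ) (A := ℚ) 1
  simp only [Nat.cast_one, pow_one] at h
  rw [oneSubFourXPow, h, map_add, map_one, rescale_X, map_neg, map_ofNat]
  ring

theorem constantCoeff_oneSubFourXPow (a : ℚ) : constantCoeff (oneSubFourXPow a) = 1 := by
  rw [oneSubFourXPow, ← coeff_zero_eq_constantCoeff_apply, coeff_rescale]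
  simp

theorem oneSubFourXPow_half : oneSubFourXPow (1 / 2) = 1 - 2 * (X * catalanGF) := by
  have h1 : oneSubFourXPow (1 / 2) * oneSubFourXPow (1 / 2) = 1 - 4 * X := by
    rw [← oneSubFourXPow_add, ← oneSubFourXPow_one]
    norm_num
  have h2 : (oneSubFourXPow (1 / 2) - (1 - 2 * (X * catalanGF))) *
      (oneSubFourXPow (1 / 2) + (1 - 2 * (X * catalanGF))) = 0 := by
    linear_combination h1 - 4 * X * catalanGF_eq
  rcases mul_eq_zero.1 h2 with h | h
  · exact sub_eq_zero.1 h
  · have := congrArg (constantCoeff (R := ℚ)) h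
    simp [constantCoeff_oneSubFourXPow] at this

theorem mk_total_pat231_eq_occGF :
    (PowerSeries.mk fun n => (total pat231 (Av n pat123) : ℚ)) = occGF 0 := by
  ext n
  rw [coeff_mk, total_pat231_eq_total_pat312]
  simp [occGF, lowGF, avLow_zero, total]

end PermPattern

open PowerSeries PermPattern in
/-- All inverses are of power series with constant coefficient `1`. -/
theorem mainTheorem3 :
    (∀ n : ℕ, total pat231 (Av n pat123) = total pat312 (Av n pat123)) ∧
    (PowerSeries.mk fun n => (total pat231 (Av n pat123) : ℚ)) =
      X ^ 3 * catalanGF ^ 3 * ((1 - 2 * X * catalanGF) * oneSubFourXPow (3 / 2))⁻¹ ∧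
    (PowerSeries.mk fun n => (total pat231 (Av n pat123) : ℚ)) =
      C (1 / 2 : ℚ) * ((1 - 3 * X) * ((1 - 4 * X) ^ 2)⁻¹ -
        (4 * X ^ 2 - 5 * X + 1) * (oneSubFourXPow (5 / 2))⁻¹) := by
  refine ⟨total_pat231_eq_total_pat312, ?_⟩
  rw [mk_total_pat231_eq_occGF]
  have hcat := catalanGF_eq
  have hhalf := oneSubFourXPow_half
  have h3 : oneSubFourXPow (3 / 2) = (1 - 4 * X) * oneSubFourXPow (1 / 2) := by
    rw [← oneSubFourXPow_one, ← oneSubFourXPow_add]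
    norm_num
  have h5 : oneSubFourXPow (5 / 2) = (1 - 4 * X) * oneSubFourXPow (3 / 2) := by
    rw [← oneSubFourXPow_one, ← oneSubFourXPow_add]
    norm_num
  have hr : X = X * catalanGF * (1 - X * catalanGF) := by linear_combination X * hcat
  have hc : catalanGF * (1 - X * catalanGF) = 1 := by linear_combination -hcat
  have hw : (1 - 2 * (X * catalanGF))⁻¹ * (1 - 2 * (X * catalanGF)) = 1 :=
    PowerSeries.inv_mul_cancel _ (by simp)
  have hB := occGF_eq hr hc hw 0
  have h2 : C (1 / 2 : ℚ) * 2 = (1 : ℚ⟦X⟧) := by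
    rw [← map_ofNat (C (R := ℚ)) 2, ← map_mul]; norm_num
  have h4 : (1 - 4 * X : ℚ⟦X⟧) = (1 - 2 * (X * catalanGF)) ^ 2 := by
    linear_combination -4 * X * hcat
  have hpow (n : ℕ) : (1 - 2 * (X * catalanGF))⁻¹ ^ n * (1 - 2 * (X * catalanGF)) ^ n = 1 := by
    rw [← mul_pow, hw, one_pow]
  have e1 : ((1 - 2 * X * catalanGF) * oneSubFourXPow (3 / 2))⁻¹ =
      (1 - 2 * (X * catalanGF))⁻¹ ^ 4 := by
    rw [PowerSeries.inv_eq_iff_mul_eq_one (by simp [constantCoeff_oneSubFourXPow]), h3, hhalf, h4,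
      mul_assoc 2 X]
    linear_combination hpow 4
  have e2 : ((1 - 4 * X : ℚ⟦X⟧) ^ 2)⁻¹ = (1 - 2 * (X * catalanGF))⁻¹ ^ 4 := by
    rw [PowerSeries.inv_eq_iff_mul_eq_one (by simp), h4]
    linear_combination hpow 4
  have e3 : (oneSubFourXPow (5 / 2))⁻¹ = (1 - 2 * (X * catalanGF))⁻¹ ^ 5 := by
    rw [PowerSeries.inv_eq_iff_mul_eq_one (by simp [constantCoeff_oneSubFourXPow]), h5, h3, hhalf,
      h4]
    linear_combination hpow 5
  rw [e1, e2, e3, hB]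
  constructor
  · push_cast
    ring
  · generalize (1 - 2 * (X * catalanGF))⁻¹ = w at *
    have h45 : (4 * X ^ 2 - 5 * X + 1 : ℚ⟦X⟧) * w ^ 5 =
        (1 - X) * (1 - 2 * (X * catalanGF)) * w ^ 4 := by
      linear_combination w ^ 5 * (1 - X) * h4 + (1 - X) * (1 - 2 * (X * catalanGF)) * w ^ 4 * hw
    rw [h45]
    push_cast
    generalize X * catalanGF = r at *
    linear_combination (-r ^ 3 * w ^ 4) * h2 -
      C (1 / 2) * w ^ 4 * (-3 + (1 - 2 * r)) * hr
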